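/- **Setting.** Let $\mathcal S,\mathcal A$ be finite sets with $|\mathcal S|=S$ contexts and $|\mathcal A|=A$ actions, and let contexts be drawn from $\rho=\mathrm{Unif}(\mathcal S)$. An instance consists of a reward function $r:\mathcal S\times\mathcal A\to[0,1]$ and a reference policy $\pi^{\mathrm{ref}}\in\Delta(\mathcal A\mid\mathcal S)$, with regularization parameter $\eta>0$. The KL-regularized objective of a policy $\pi\in\Delta(\mathcal A\mid\mathcal S)$ is $$J(\pi)=\mathbb E_{s\sim\rho,\,a\sim\pi(\cdot\mid s)}\Big[r(s,a)-\eta^{-1}\log\frac{\pi(a\mid s)}{\pi^{\mathrm{ref}}(a\mid s)}\Big]$$ ($=-\infty$ if $\pi(\cdot\mid s)\not\ll\pi^{\mathrm{ref}}(\cdot\mid s)$ for some $s$). It is maximized by $\pi^*_r(\cdot\mid s)\propto\pi^{\mathrm{ref}}(\cdot\mid s)\exp(\eta\, r(s,\cdot))$, and $\mathrm{SubOpt}(\pi)=J(\pi^*_r)-J(\pi)$. Let $\mathrm{MAB}(C^*)$ be the class of instances $(r,\eta,\pi^{\mathrm{ref}})$ with $\sup_{s,a}\pi^*_r(a\mid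 s)/\pi^{\mathrm{ref}}(a\mid s)\le C^*$ (with $0/0=0$). The dataset $\mathcal D$ consists of $n$ i.i.d. triples $(s_i,a_i,r_i)$ with $s_i\sim\rho$, $a_i\sim\pi^{\mathrm{ref}}(\cdot\mid s_i)$ and $r_i=r(s_i,a_i)+\varepsilon_i$, where $\varepsilon_i\sim N(0,1)$ is independent of $(s_i,a_i)$. An algorithm $\mathtt{Alg}$ maps the dataset measurably to a policy; it may depend on $S,A,n,\eta,C^*,\rho$, the noise law and $\pi^{\mathrm{ref}}$, but not on $r$. **Theorem.** There are absolute constants $K,c>0$ such that for all integers $S>1$, $A>3$, $n$ and all reals $\eta\ge 10\log A$, $C^*\in(4,e^{\eta/2}]$ with $$n\ \ge\ SAC^*\log A\qquad\text{and}\qquad \eta^2\ \ge\ K\,\frac{n\log A}{SAC^*}$$ (the small-regularization regime), one has $$\inf_{\mathtt{Alg}}\ \sup_{(r,\eta,\pi^{\mathrm{ref}})\in\mathrm{MAB}(C^*)}\ \mathbb E_{\mathcal D}\big[\mathrm{SubOpt}(\mathtt{Alg}(\mathcal D))\big]\ \ge\ c\,\sqrt{\frac{SAC^*}{n\log A}}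 .$$ -/

import Mathlib

open MeasureTheory ProbabilityTheory
open scoped ENNReal

namespace KLBandit

noncomputable section

/-- A policy, i.e. a probability kernel from the finite context set `𝒮` to the finite
action set `𝒜`: `π s a` is the probability `π(a | s)`. -/
abbrev Policy (𝒮 𝒜 : Type*) [Fintype 𝒜] : Type _ :=
  {π : 𝒮 → 𝒜 → ℝ // ∀ s, π s ∈ stdSimplex ℝ 𝒜}

/-- The uniform distribution on a non-empty finite set. -/
def unif (𝒮 : Type*) [Fintype 𝒮] [Nonempty 𝒮] : stdSimplex ℝ 𝒮 :=
  ⟨fun _ => (Fintype.card 𝒮 : ℝ)⁻¹, fun _ => by positivity, by simp⟩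

/-- The part `(r, π^ref)` of a bandit instance `(r, η, π^ref)` that varies while `η` is fixed:
a reward function with values in `[0, 1]` and a reference (= behavior) policy. -/
structure Instance (𝒮 𝒜 : Type*) [Fintype 𝒜] where
  reward : 𝒮 → 𝒜 → ℝ
  reward_mem : ∀ s a, reward s a ∈ Set.Icc (0 : ℝ) 1
  refPolicy : Policy 𝒮 𝒜

section Objective

variable {𝒮 𝒜 : Type*} [Fintype 𝒜]

/-- The normalizing constant `∑ₐ π^ref(a | s) exp (η r(s, a))`. -/
def partition (η : ℝ) (I : Instance 𝒮 𝒜) (s : 𝒮) : ℝ :=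
  ∑ a, I.refPolicy.1 s a * Real.exp (η * I.reward s a)

theorem partition_pos (η : ℝ) (I : Instance 𝒮 𝒜) (s : 𝒮) : 0 < partition η I s := by
  have hnn : ∀ a ∈ Finset.univ, 0 ≤ I.refPolicy.1 s a * Real.exp (η * I.reward s a) :=
    fun a _ => mul_nonneg ((I.refPolicy.2 s).1 a) (Real.exp_pos _).le
  refine lt_of_le_of_ne (Finset.sum_nonneg hnn) fun h => ?_
  have h0 := (Finset.sum_eq_zero_iff_of_nonneg hnn).1 h.symm
  have h1 : ∑ a, I.refPolicy.1 s a = 0 := Finset.sum_eq_zero fun a ha => by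
    rcases mul_eq_zero.1 (h0 a ha) with h2 | h2
    · exact h2
    · exact absurd h2 (Real.exp_pos _).ne'
  rw [(I.refPolicy.2 s).2] at h1
  exact one_ne_zero h1

/-- The optimal policy `π*(· | s) ∝ π^ref(· | s) exp (η r(s, ·))`. -/
def optPolicy (η : ℝ) (I : Instance 𝒮 𝒜) : Policy 𝒮 𝒜 :=
  ⟨fun s a => I.refPolicy.1 s a * Real.exp (η * I.reward s a) / partition η I s, fun s =>
    ⟨fun a => div_nonneg (mul_nonneg ((I.refPolicy.2 s).1 a) (Real.exp_pos _).le)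
      (partition_pos η I s).le, by
      rw [← Finset.sum_div]
      exact div_self (partition_pos η I s).ne'⟩⟩

/-- The concentrability `sup_{s, a} π*(a | s) / π^ref(a | s)` of the optimal policy (with
`0 / 0 = 0`; note that `π*(a | s) = 0` wherever `π^ref(a | s) = 0`). -/
def concentrability (η : ℝ) (I : Instance 𝒮 𝒜) : ℝ :=
  ⨆ p : 𝒮 × 𝒜, (optPolicy η I).1 p.1 p.2 / I.refPolicy.1 p.1 p.2

/-- The class `MAB(C)` of instances with concentrability at most `C`. -/
def MAB (𝒮 𝒜 : Type*) [Fintype 𝒜] (η C : ℝ) : Set (Instance 𝒮 𝒜) :=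
  {I | concentrability η I ≤ C}

variable [Fintype 𝒮]

/-- `J(π) = 𝔼_{s ∼ ρ, a ∼ π(· | s)} [ r(s, a) - η⁻¹ log (π(a | s) / π^ref(a | s)) ]`, for
policies `π` that are absolutely continuous with respect to `π^ref` on the support of `ρ`.
(For all other policies the mathematical value is `-∞`; see `subOpt`.) -/
def objective (ρ : stdSimplex ℝ 𝒮) (η : ℝ) (I : Instance 𝒮 𝒜) (π : Policy 𝒮 𝒜) : ℝ :=
  ∑ s, ρ.1 s * ∑ a, π.1 s a *
    (I.reward s a - η⁻¹ * Real.log (π.1 s a / I.refPolicy.1 s a))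

/-- `π` is absolutely continuous with respect to `π^ref` at every context in the support
of `ρ`. -/
def AbsCont (ρ : stdSimplex ℝ 𝒮) (I : Instance 𝒮 𝒜) (π : Policy 𝒮 𝒜) : Prop :=
  ∀ s a, ρ.1 s ≠ 0 → I.refPolicy.1 s a = 0 → π.1 s a = 0

theorem optPolicy_absCont (ρ : stdSimplex ℝ 𝒮) (η : ℝ) (I : Instance 𝒮 𝒜) :
    AbsCont ρ I (optPolicy η I) := by
  intro s a _ h
  simp [optPolicy, h]

/-- `optPolicy` is indeed a maximizer of the objective. -/
theorem objective_le_optPolicy (ρ : stdSimplex ℝ 𝒮) {η : ℝ} (hη : 0 < η) (I : Instance 𝒮 𝒜)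
    (π : Policy 𝒮 𝒜) (hπ : AbsCont ρ I π) :
    objective ρ η I π ≤ objective ρ η I (optPolicy η I) := by
  refine Finset.sum_le_sum fun s _ => ?_
  rcases eq_or_ne (ρ.1 s) 0 with h0 | h0
  · simp [h0]
  refine mul_le_mul_of_nonneg_left ?_ (ρ.2.1 s)
  have hZ := partition_pos η I s
  have hR : ∑ a, (optPolicy η I).1 s a *
      (I.reward s a - η⁻¹ * Real.log ((optPolicy η I).1 s a / I.refPolicy.1 s a)) =
      η⁻¹ * Real.log (partition η I s) := by
    have : ∀ a, (optPolicy η I).1 s a *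
        (I.reward s a - η⁻¹ * Real.log ((optPolicy η I).1 s a / I.refPolicy.1 s a)) =
        (optPolicy η I).1 s a * (η⁻¹ * Real.log (partition η I s)) := by
      intro a
      by_cases hq : I.refPolicy.1 s a = 0
      · simp [optPolicy, hq]
      · have e : (optPolicy η I).1 s a / I.refPolicy.1 s a =
            Real.exp (η * I.reward s a) / partition η I s := by
          simp only [optPolicy]
          field_simp
        rw [e, Real.log_div (Real.exp_pos _).ne' hZ.ne', Real.log_exp]
        field_simp
        ring
    rw [Finset.sum_congr rfl fun a _ => this a, ← Finset.sum_mul, ((optPolicy η I).2 s).2,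
      one_mul]
  rw [hR]
  have key : ∀ a, π.1 s a * (I.reward s a - η⁻¹ * Real.log (π.1 s a / I.refPolicy.1 s a)) ≤
      π.1 s a * (η⁻¹ * Real.log (partition η I s)) +
        η⁻¹ * ((optPolicy η I).1 s a - π.1 s a) := by
    intro a
    rcases ((π.2 s).1 a).eq_or_lt with hp | hp
    · rw [← hp]
      simpa using mul_nonneg (inv_pos.2 hη).le (((optPolicy η I).2 s).1 a)
    · have hq0 : I.refPolicy.1 s a ≠ 0 := fun hq => hp.ne' (hπ s a h0 hq)
      have hq : 0 < I.refPolicy.1 s a := lt_of_le_of_ne ((I.refPolicy.2 s).1 a) hq0.symm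
      have hx : 0 < (optPolicy η I).1 s a :=
        div_pos (mul_pos hq (Real.exp_pos _)) hZ
      have hl := Real.log_le_sub_one_of_pos (div_pos hx hp)
      rw [Real.log_div hx.ne' hp.ne'] at hl
      have hlx : Real.log ((optPolicy η I).1 s a) =
          Real.log (I.refPolicy.1 s a) + η * I.reward s a - Real.log (partition η I s) := by
        simp only [optPolicy]
        rw [Real.log_div (mul_pos hq (Real.exp_pos _)).ne' hZ.ne',
          Real.log_mul hq0 (Real.exp_pos _).ne', Real.log_exp]
      rw [Real.log_div hp.ne' hq0]
      have h1 := mul_le_mul_of_nonneg_left hl hp.le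
      have h2 : π.1 s a * ((optPolicy η I).1 s a / π.1 s a - 1) =
          (optPolicy η I).1 s a - π.1 s a := by field_simp
      rw [h2, hlx] at h1
      have h3 := mul_le_mul_of_nonneg_left h1 (inv_pos.2 hη).le
      have h4 : η⁻¹ * (π.1 s a * (Real.log (I.refPolicy.1 s a) + η * I.reward s a -
          Real.log (partition η I s) - Real.log (π.1 s a))) =
          π.1 s a * (I.reward s a - η⁻¹ * (Real.log (π.1 s a) - Real.log (I.refPolicy.1 s a))) -
          π.1 s a * (η⁻¹ * Real.log (partition η I s)) := by
        field_simp
        ring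
      linarith
  refine (Finset.sum_le_sum fun a _ => key a).trans (le_of_eq ?_)
  rw [Finset.sum_add_distrib, ← Finset.sum_mul, ← Finset.mul_sum, Finset.sum_sub_distrib,
    (π.2 s).2, ((optPolicy η I).2 s).2]
  ring

open scoped Classical in
/-- The suboptimality gap `SubOpt(π) = J(π*) - J(π)`, with value `∞` when `J(π) = -∞`. -/
def subOpt (ρ : stdSimplex ℝ 𝒮) (η : ℝ) (I : Instance 𝒮 𝒜) (π : Policy 𝒮 𝒜) : ℝ≥0∞ :=
  if AbsCont ρ I π then
    ENNReal.ofReal (objective ρ η I (optPolicy η I) - objective ρ η I π)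
  else ⊤

end Objective

section Sampling

variable {𝒮 𝒜 : Type*} [Fintype 𝒮] [Fintype 𝒜] [MeasurableSpace 𝒮] [MeasurableSpace 𝒜]

/-- The law of one observation `(s, a, r(s, a) + ε)`, where `s ∼ ρ`, `a ∼ π^ref(· | s)` and
the noise `ε ∼ ξ` is independent of `(s, a)`. -/
def sampleLaw (ρ : stdSimplex ℝ 𝒮) (ξ : Measure ℝ) (I : Instance 𝒮 𝒜) :
    Measure (𝒮 × 𝒜 × ℝ) :=
  ∑ s, ∑ a, ENNReal.ofReal (ρ.1 s * I.refPolicy.1 s a) •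
    ξ.map (fun ε => (s, a, I.reward s a + ε))

instance sampleLaw_isProbabilityMeasure (ρ : stdSimplex ℝ 𝒮) (ξ : Measure ℝ)
    [IsProbabilityMeasure ξ] (I : Instance 𝒮 𝒜) :
    IsProbabilityMeasure (sampleLaw ρ ξ I) := by
  constructor
  have h : ∀ s a, ξ.map (fun ε : ℝ => (s, a, I.reward s a + ε)) Set.univ = 1 := by
    intro s a
    rw [Measure.map_apply (by fun_prop) MeasurableSet.univ]
    simp
  simp only [sampleLaw, Measure.coe_finsetSum, Finset.sum_apply, Measure.smul_apply, h,
    smul_eq_mul, mul_one]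
  have hs : ∀ s, ∑ a, ENNReal.ofReal (ρ.1 s * I.refPolicy.1 s a) = ENNReal.ofReal (ρ.1 s) := by
    intro s
    rw [← ENNReal.ofReal_sum_of_nonneg fun a _ => mul_nonneg (ρ.2.1 s) ((I.refPolicy.2 s).1 a),
      ← Finset.mul_sum, (I.refPolicy.2 s).2, mul_one]
  rw [Finset.sum_congr rfl fun s _ => hs s,
    ← ENNReal.ofReal_sum_of_nonneg fun s _ => ρ.2.1 s, ρ.2.2, ENNReal.ofReal_one]

/-- The law of a dataset of `n` i.i.d. observations. -/
def dataLaw (ρ : stdSimplex ℝ 𝒮) (ξ : Measure ℝ) (I : Instance 𝒮 𝒜) (n : ℕ) :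
    Measure (Fin n → 𝒮 × 𝒜 × ℝ) :=
  Measure.pi fun _ => sampleLaw ρ ξ I

/-- An offline learning algorithm: it knows the reference policy, reads a dataset of size `n`
and outputs a policy, measurably in the dataset. (Everything else but the reward function is
fixed before the algorithm is chosen, hence may be used by it as well.) -/
structure Algorithm (𝒮 𝒜 : Type*) [Fintype 𝒜] [MeasurableSpace 𝒮] [MeasurableSpace 𝒜]
    (n : ℕ) where
  run : Policy 𝒮 𝒜 → (Fin n → 𝒮 × 𝒜 × ℝ) → Policy 𝒮 𝒜
  measurable_run : ∀ πref, Measurable (run πref)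

/-- The expected suboptimality `𝔼_D [SubOpt(Alg(D))]` of an algorithm on an instance. -/
def risk (ρ : stdSimplex ℝ 𝒮) (ξ : Measure ℝ) (η : ℝ) (n : ℕ)
    (alg : Algorithm 𝒮 𝒜 n) (I : Instance 𝒮 𝒜) : ℝ≥0∞ :=
  ∫⁻ D, subOpt ρ η I (alg.run I.refPolicy D) ∂(dataLaw ρ ξ I n)

/-- The minimax risk `inf_Alg sup_{I ∈ MAB(C)} 𝔼_D [SubOpt(Alg(D))]`, for the context
distribution `ρ` and the noise distribution `ξ`. -/
def minimaxRisk (ρ : stdSimplex ℝ 𝒮) (ξ : Measure ℝ) (𝒜 : Type*) [Fintype 𝒜]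
    [MeasurableSpace 𝒜] (η C : ℝ) (n : ℕ) : ℝ≥0∞ :=
  ⨅ alg : Algorithm 𝒮 𝒜 n, ⨆ I ∈ MAB 𝒮 𝒜 η C, risk ρ ξ η n alg I

end Sampling

end

end KLBandit

/-!
Under the small regularization considered here, the KL term cannot hedge against ignorance of the
best actions. The hard instances (`hardInstance`) group most of the actions into pairs. At each
context and in each pair, a hidden sign decides which of the two actions has reward `1`; the other
one has reward `1 - Δ`. The paired actions have mass `2 / C` under the reference policy
(`hardRef`), spread evenly, and the spare actions have reward `0`. Exactly half of the paired mass
is good whatever the signs are, so the partition function is at least `exp η / C`, which bounds the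
concentrability by `C` (`hardInstance_mem_MAB`).

Raising the rewards to `1` on all paired actions and to `1 / 2` on the spare ones multiplies the
partition function by at most `3`, because `exp (η / 2) ≤ exp η / C`. By the Gibbs variational
principle, applied to the raised rewards, a policy loses at least `Δ` times the mass that it puts
outside the good actions, up to `log 3 / η` (`le_subOpt_hardInstance`). Since `η` is large against
`1 / Δ`, this correction is negligible.

It remains to see that, on average over the signs, no policy learned from the data can put almost
all its mass on good actions. A learner may look for the pair whose data are most conclusive, and
this is the origin of the factor `log A`. Reversing the sign of a pair exchanges its good and bad
action and multiplies the law of the data by a likelihood ratio (`dataLaw_eq_withDensity`). If, with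
probability at least `1 / 2`, the likelihood ratios of all pairs at a context are at least
`exp (-2)`, then the average bad mass is at least `exp (-2)` times the average good mass on that
event, and a constant part of the mass is not good
(`card_mul_le_sum_lintegral_one_sub_goodMass`). A pair is observed about `n / (S C A)` times, up to
constants, so its log-likelihood ratio is roughly Gaussian with variance `Δ² n / (S C A)`; a
Chernoff bound with exponent `log A` and a union bound over the pairs give the required event for
`Δ` a small multiple of `√(S A C / (n log A))` (`dataLaw_exists_logLR_lt_le`). The condition
`n ≥ S A C log A` makes `Δ log A` bounded, so that the random number of observations of a pair is
harmless.
-/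

namespace KLBandit


/-! ### Likelihood ratios between Gaussian bandit instances -/

theorem lintegral_prod_pi {ι Ω : Type*} [Fintype ι] [MeasurableSpace Ω] (μ : Measure Ω)
    [IsProbabilityMeasure μ] {g : ι → Ω → ℝ≥0∞} (hg : ∀ i, Measurable (g i)) :
    ∫⁻ x, ∏ i, g i (x i) ∂(Measure.pi fun _ : ι => μ) = ∏ i, ∫⁻ y, g i y ∂μ := by
  rw [lintegral_prod_eq_prod_lintegral_of_indepFun Finset.univ
    (fun i (x : ι → Ω) => g i (x i)) (iIndepFun_pi fun i => (hg i).aemeasurable)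
    fun i => (hg i).comp (measurable_pi_apply i)]
  exact Finset.prod_congr rfl fun i _ =>
    (measurePreserving_eval (fun _ : ι => μ) i).lintegral_comp (hg i)

theorem pi_withDensity_prod {ι Ω : Type*} [Fintype ι] [MeasurableSpace Ω] (μ : Measure Ω)
    [IsProbabilityMeasure μ] {f : Ω → ℝ≥0∞} (hf : Measurable f)
    [IsProbabilityMeasure (μ.withDensity f)] :
    Measure.pi (fun _ : ι => μ.withDensity f) =
      (Measure.pi fun _ : ι => μ).withDensity fun x => ∏ i, f (x i) := by
  refine Measure.pi_eq fun s hs => ?_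
  rw [withDensity_apply _ (MeasurableSet.univ_pi hs),
    ← lintegral_indicator (MeasurableSet.univ_pi hs)]
  have h : ∀ x : ι → Ω, (Set.univ.pi s).indicator (fun x => ∏ i, f (x i)) x =
      ∏ i, (s i).indicator f (x i) := by
    intro x
    by_cases hx : x ∈ Set.univ.pi s
    · rw [Set.indicator_of_mem hx]
      exact Finset.prod_congr rfl fun i _ => (Set.indicator_of_mem (hx i trivial) f).symm
    · rw [Set.indicator_of_notMem hx]
      obtain ⟨i, hi⟩ : ∃ i, x i ∉ s i := by simpa [Set.mem_pi] using hx
      exact (Finset.prod_eq_zero (Finset.mem_univ i) (Set.indicator_of_notMem hi f)).symm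
  rw [lintegral_congr h, lintegral_prod_pi μ fun i => hf.indicator (hs i)]
  exact Finset.prod_congr rfl fun i _ => by
    rw [withDensity_apply _ (hs i), lintegral_indicator (hs i)]

theorem lintegral_exp_mul_gaussianReal (t : ℝ) :
    ∫⁻ x, ENNReal.ofReal (Real.exp (t * x)) ∂(gaussianReal 0 1) =
      ENNReal.ofReal (Real.exp (t ^ 2 / 2)) := by
  rw [← ofReal_integral_eq_lintegral_ofReal (integrable_exp_mul_gaussianReal t)
    (Filter.Eventually.of_forall fun _ => (Real.exp_pos _).le)]
  have h := congrFun (mgf_id_gaussianReal (μ := 0) (v := 1)) t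
  simp only [mgf, id] at h
  rw [h]
  simp

theorem gaussianReal_eq_withDensity (m d : ℝ) :
    gaussianReal (m + d) 1 = (gaussianReal m 1).withDensity
      fun y => ENNReal.ofReal (Real.exp (d * (y - m) - d ^ 2 / 2)) := by
  rw [gaussianReal_of_var_ne_zero _ one_ne_zero, gaussianReal_of_var_ne_zero _ one_ne_zero,
    ← withDensity_mul _ (measurable_gaussianPDF m 1) (by fun_prop)]
  congr 1
  ext y
  rw [Pi.mul_apply, gaussianPDF, gaussianPDF, ← ENNReal.ofReal_mul (gaussianPDFReal_nonneg _ _ _),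
    gaussianPDFReal_def, gaussianPDFReal_def]
  dsimp only
  rw [mul_assoc (_)⁻¹, ← Real.exp_add]
  congr 3
  simp only [NNReal.coe_one]
  ring

section LikelihoodRatio

variable {𝒮 𝒜 : Type*} [Fintype 𝒜]

/-- The log-likelihood ratio of one observation, under unit Gaussian noise, of the instance `I'`
relative to `I`, for two instances with the same reference policy. -/
noncomputable def logLR (I I' : Instance 𝒮 𝒜) (x : 𝒮 × 𝒜 × ℝ) : ℝ :=
  (I'.reward x.1 x.2.1 - I.reward x.1 x.2.1) * (x.2.2 - I.reward x.1 x.2.1) -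
    (I'.reward x.1 x.2.1 - I.reward x.1 x.2.1) ^ 2 / 2

variable [Fintype 𝒮] [MeasurableSpace 𝒮] [MeasurableSpace 𝒜]

theorem lintegral_sampleLaw (ρ : stdSimplex ℝ 𝒮) (I : Instance 𝒮 𝒜) {f : 𝒮 × 𝒜 × ℝ → ℝ≥0∞}
    (hf : Measurable f) :
    ∫⁻ x, f x ∂(sampleLaw ρ (gaussianReal 0 1) I) =
      ∑ s, ∑ a, ENNReal.ofReal (ρ.1 s * I.refPolicy.1 s a) *
        ∫⁻ y, f (s, a, y) ∂(gaussianReal (I.reward s a) 1) := by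
  simp only [sampleLaw, lintegral_finsetSum_measure, lintegral_smul_measure, smul_eq_mul]
  refine Finset.sum_congr rfl fun s _ => Finset.sum_congr rfl fun a _ => ?_
  congr 1
  have hg : gaussianReal (I.reward s a) 1 =
      (gaussianReal 0 1).map fun ε => I.reward s a + ε := by
    rw [gaussianReal_map_const_add, zero_add]
  rw [hg, lintegral_map hf (by fun_prop), lintegral_map (by fun_prop) (by fun_prop)]

variable [MeasurableSingletonClass 𝒮] [MeasurableSingletonClass 𝒜]

@[fun_prop]
theorem measurable_logLR (I I' : Instance 𝒮 𝒜) : Measurable (logLR I I') :=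
  measurable_from_prod_countable_right fun s => measurable_from_prod_countable_right fun a => by
    unfold logLR
    fun_prop

theorem sampleLaw_eq_withDensity (ρ : stdSimplex ℝ 𝒮) {I I' : Instance 𝒮 𝒜}
    (h : I'.refPolicy = I.refPolicy) :
    sampleLaw ρ (gaussianReal 0 1) I' = (sampleLaw ρ (gaussianReal 0 1) I).withDensity
      fun x => ENNReal.ofReal (Real.exp (logLR I I' x)) := by
  refine Measure.ext_of_lintegral _ fun f hf => ?_
  rw [lintegral_withDensity_eq_lintegral_mul _ (by fun_prop) hf, lintegral_sampleLaw _ _ hf,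
    lintegral_sampleLaw _ _ (by fun_prop), h]
  refine Finset.sum_congr rfl fun s _ => Finset.sum_congr rfl fun a _ => ?_
  have hr : I'.reward s a = I.reward s a + (I'.reward s a - I.reward s a) := by ring
  rw [hr, gaussianReal_eq_withDensity, lintegral_withDensity_eq_lintegral_mul _ (by fun_prop)
    (by fun_prop)]
  rfl

/-- The moments of the inverse likelihood ratio of one observation. -/
theorem lintegral_exp_neg_logLR (ρ : stdSimplex ℝ 𝒮) (I I' : Instance 𝒮 𝒜) (l : ℝ) :
    ∫⁻ x, ENNReal.ofReal (Real.exp (-l * logLR I I' x)) ∂(sampleLaw ρ (gaussianReal 0 1) I) =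
      ENNReal.ofReal (∑ s, ∑ a, ρ.1 s * I.refPolicy.1 s a *
        Real.exp ((l ^ 2 + l) * (I'.reward s a - I.reward s a) ^ 2 / 2)) := by
  have hnn : ∀ s a, 0 ≤ ρ.1 s * I.refPolicy.1 s a := fun s a =>
    mul_nonneg (ρ.2.1 s) ((I.refPolicy.2 s).1 a)
  rw [lintegral_sampleLaw _ _ (by fun_prop), ENNReal.ofReal_sum_of_nonneg fun s _ =>
    Finset.sum_nonneg fun a _ => mul_nonneg (hnn s a) (Real.exp_pos _).le]
  refine Finset.sum_congr rfl fun s _ => ?_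
  rw [ENNReal.ofReal_sum_of_nonneg fun a _ => mul_nonneg (hnn s a) (Real.exp_pos _).le]
  refine Finset.sum_congr rfl fun a _ => ?_
  rw [ENNReal.ofReal_mul (hnn s a)]
  congr 1
  set d := I'.reward s a - I.reward s a with hd
  have hg : gaussianReal (I.reward s a) 1 =
      (gaussianReal 0 1).map fun ε => I.reward s a + ε := by
    rw [gaussianReal_map_const_add, zero_add]
  rw [hg, lintegral_map (by fun_prop) (by fun_prop)]
  have he : ∀ ε : ℝ, ENNReal.ofReal (Real.exp (-l * logLR I I' (s, a, I.reward s a + ε))) =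
      ENNReal.ofReal (Real.exp (l * d ^ 2 / 2)) * ENNReal.ofReal (Real.exp (-(l * d) * ε)) := by
    intro ε
    rw [← ENNReal.ofReal_mul (Real.exp_pos _).le, ← Real.exp_add]
    congr 2
    simp only [logLR, ← hd]
    ring
  rw [lintegral_congr he, lintegral_const_mul _ (by fun_prop), lintegral_exp_mul_gaussianReal,
    ← ENNReal.ofReal_mul (Real.exp_pos _).le, ← Real.exp_add]
  congr 2
  ring

theorem dataLaw_eq_withDensity (ρ : stdSimplex ℝ 𝒮) {I I' : Instance 𝒮 𝒜}
    (h : I'.refPolicy = I.refPolicy) (n : ℕ) :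
    dataLaw ρ (gaussianReal 0 1) I' n = (dataLaw ρ (gaussianReal 0 1) I n).withDensity
      fun D => ENNReal.ofReal (Real.exp (∑ i, logLR I I' (D i))) := by
  have hp : IsProbabilityMeasure ((sampleLaw ρ (gaussianReal 0 1) I).withDensity
      fun x => ENNReal.ofReal (Real.exp (logLR I I' x))) := by
    rw [← sampleLaw_eq_withDensity ρ h]
    infer_instance
  rw [dataLaw, sampleLaw_eq_withDensity ρ h, pi_withDensity_prod _ (by fun_prop)]
  simp only [Real.exp_sum, ENNReal.ofReal_prod_of_nonneg fun _ _ => (Real.exp_pos _).le]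
  rfl

/-- Chernoff bound: with high probability the likelihood ratio of the data is not small. -/
theorem dataLaw_logLR_lt_le (ρ : stdSimplex ℝ 𝒮) (I I' : Instance 𝒮 𝒜) (n : ℕ) {l : ℝ}
    (hl : 0 ≤ l) (t : ℝ) :
    dataLaw ρ (gaussianReal 0 1) I n {D | ∑ i, logLR I I' (D i) < -t} ≤
      ENNReal.ofReal (Real.exp (-(l * t)) * (∑ s, ∑ a, ρ.1 s * I.refPolicy.1 s a *
        Real.exp ((l ^ 2 + l) * (I'.reward s a - I.reward s a) ^ 2 / 2)) ^ n) := by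
  have hM : ∫⁻ D, ENNReal.ofReal (Real.exp (-(l * t)) * Real.exp (-l * ∑ i, logLR I I' (D i)))
      ∂(dataLaw ρ (gaussianReal 0 1) I n) =
      ENNReal.ofReal (Real.exp (-(l * t)) * (∑ s, ∑ a, ρ.1 s * I.refPolicy.1 s a *
        Real.exp ((l ^ 2 + l) * (I'.reward s a - I.reward s a) ^ 2 / 2)) ^ n) := by
    simp only [ENNReal.ofReal_mul (Real.exp_pos _).le, Finset.mul_sum, Real.exp_sum,
      ENNReal.ofReal_prod_of_nonneg fun _ _ => (Real.exp_pos _).le]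
    rw [lintegral_const_mul _ (by fun_prop), dataLaw,
      lintegral_prod_pi (g := fun _ x => ENNReal.ofReal (Real.exp (-l * logLR I I' x))) _
        fun _ => by fun_prop]
    simp only [lintegral_exp_neg_logLR, Finset.prod_const, Finset.card_univ, Fintype.card_fin]
    rw [ENNReal.ofReal_pow]
    exact Finset.sum_nonneg fun s _ => Finset.sum_nonneg fun a _ =>
      mul_nonneg (mul_nonneg (ρ.2.1 s) ((I.refPolicy.2 s).1 a)) (Real.exp_pos _).le
  rw [← hM, ← one_mul (lintegral _ _)]
  have hm : Measurable fun D : Fin n → 𝒮 × 𝒜 × ℝ => ENNReal.ofReal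
      (Real.exp (-(l * t)) * Real.exp (-l * ∑ i, logLR I I' (D i))) := by fun_prop
  refine le_trans (measure_mono fun D hD => ?_)
    ((one_mul _).symm.le.trans ((mul_meas_ge_le_lintegral hm 1).trans (one_mul _).symm.le))
  rw [Set.mem_ofPred_eq] at hD ⊢
  rw [← Real.exp_add, ENNReal.one_le_ofReal]
  refine Real.one_le_exp ?_
  nlinarith

end LikelihoodRatio


/-! ### The value of the optimal policy -/

section Value

variable {𝒮 𝒜 : Type*} [Fintype 𝒜] [Fintype 𝒮]

/-- The optimal value is the log-partition function (Gibbs variational principle). -/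
theorem objective_optPolicy (ρ : stdSimplex ℝ 𝒮) {η : ℝ} (hη : η ≠ 0) (I : Instance 𝒮 𝒜) :
    objective ρ η I (optPolicy η I) = ∑ s, ρ.1 s * (η⁻¹ * Real.log (partition η I s)) := by
  refine Finset.sum_congr rfl fun s _ => ?_
  congr 1
  have hZ := partition_pos η I s
  have h : ∀ a, (optPolicy η I).1 s a *
      (I.reward s a - η⁻¹ * Real.log ((optPolicy η I).1 s a / I.refPolicy.1 s a)) =
      (optPolicy η I).1 s a * (η⁻¹ * Real.log (partition η I s)) := by
    intro a
    by_cases hq : I.refPolicy.1 s a = 0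
    · simp [optPolicy, hq]
    · have e : (optPolicy η I).1 s a / I.refPolicy.1 s a =
          Real.exp (η * I.reward s a) / partition η I s := by
        simp only [optPolicy]
        field_simp
      rw [e, Real.log_div (Real.exp_pos _).ne' hZ.ne', Real.log_exp]
      field_simp
      ring
  rw [Finset.sum_congr rfl fun a _ => h a, ← Finset.sum_mul, ((optPolicy η I).2 s).2, one_mul]

/-- Comparison of an instance `I` with a relaxation `I'` whose partition function is at most `B`
times larger: every policy pays for the difference of the rewards, up to `log B / η`. -/
theorem le_objective_sub_objective {ρ : stdSimplex ℝ 𝒮} {η : ℝ} (hη : 0 < η)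
    {I I' : Instance 𝒮 𝒜} (h : I'.refPolicy = I.refPolicy) {π : Policy 𝒮 𝒜}
    (hπ : AbsCont ρ I π) {B : ℝ} (hB : 0 < B)
    (hZ : ∀ s, partition η I' s ≤ B * partition η I s) :
    (∑ s, ρ.1 s * ∑ a, π.1 s a * (I'.reward s a - I.reward s a)) - Real.log B / η ≤
      objective ρ η I (optPolicy η I) - objective ρ η I π := by
  have hgibbs := objective_le_optPolicy ρ hη I' π (by rwa [AbsCont, h])
  have hdiff : objective ρ η I' π = objective ρ η I π +
      ∑ s, ρ.1 s * ∑ a, π.1 s a * (I'.reward s a - I.reward s a) := by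
    simp only [objective, h, ← Finset.sum_add_distrib, ← mul_add]
    refine Finset.sum_congr rfl fun s _ => ?_
    congr 1
    exact Finset.sum_congr rfl fun a _ => by ring
  have hopt : objective ρ η I' (optPolicy η I') ≤
      objective ρ η I (optPolicy η I) + Real.log B / η := by
    rw [objective_optPolicy ρ hη.ne', objective_optPolicy ρ hη.ne']
    have hone : Real.log B / η = ∑ s, ρ.1 s * (Real.log B / η) := by
      rw [← Finset.sum_mul, ρ.2.2, one_mul]
    rw [hone, ← Finset.sum_add_distrib]
    refine Finset.sum_le_sum fun s _ => ?_
    rw [← mul_add]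
    refine mul_le_mul_of_nonneg_left ?_ (ρ.2.1 s)
    have hl := Real.log_le_log (partition_pos η I' s) (hZ s)
    rw [Real.log_mul hB.ne' (partition_pos η I s).ne'] at hl
    have := mul_le_mul_of_nonneg_left hl (inv_pos.2 hη).le
    rw [div_eq_inv_mul]
    linarith
  linarith

end Value

/-! ### The family of hard instances -/

section Hard

variable {𝒮 𝒜 P R : Type*} [Fintype 𝒜] [Fintype P]

/-- The mass that the policy `π` puts at the context `s` on the actions of reward `1` of the hard
instance with signs `σ`. -/
def goodMass (ε : 𝒜 ≃ (P × Bool) ⊕ R) (σ : 𝒮 → P → Bool) (π : Policy 𝒮 𝒜) (s : 𝒮) : ℝ :=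
  ∑ p, π.1 s (ε.symm (.inl (p, σ s p)))

/-- The mass that the policy `π` puts at the context `s` on the paired actions of reward `1 - Δ`
of the hard instance with signs `σ`. -/
def badMass (ε : 𝒜 ≃ (P × Bool) ⊕ R) (σ : 𝒮 → P → Bool) (π : Policy 𝒮 𝒜) (s : 𝒮) : ℝ :=
  ∑ p, π.1 s (ε.symm (.inl (p, !σ s p)))

theorem goodMass_nonneg (ε : 𝒜 ≃ (P × Bool) ⊕ R) (σ : 𝒮 → P → Bool) (π : Policy 𝒮 𝒜) (s : 𝒮) :
    0 ≤ goodMass ε σ π s :=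
  Finset.sum_nonneg fun _ _ => (π.2 s).1 _

variable [Fintype R]

theorem sum_eq_sum_pairs (ε : 𝒜 ≃ (P × Bool) ⊕ R) (b : P → Bool) (g : 𝒜 → ℝ) :
    ∑ a, g a = ∑ p, g (ε.symm (.inl (p, b p))) + ∑ p, g (ε.symm (.inl (p, !b p))) +
      ∑ r, g (ε.symm (.inr r)) := by
  rw [← ε.symm.sum_comp, Fintype.sum_sum_type, Fintype.sum_prod_type, ← Finset.sum_add_distrib]
  congr 1
  refine Finset.sum_congr rfl fun p _ => ?_
  cases b p <;> simp [add_comm]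

/-- The reference policy of the hard instances. The actions are labelled by `ε` as paired or
spare ones; the paired actions have total mass `2 / C`, and both this and the rest are spread
uniformly. -/
noncomputable def hardRef [Nonempty P] [Nonempty R] (ε : 𝒜 ≃ (P × Bool) ⊕ R) {C : ℝ}
    (hC : 2 ≤ C) : Policy 𝒮 𝒜 :=
  ⟨fun _ a => Sum.elim (fun _ => 1 / (C * Fintype.card P))
    (fun _ => (1 - 2 / C) / Fintype.card R) (ε a), fun _ => by
    have hP : (0 : ℝ) < Fintype.card P := by exact_mod_cast Fintype.card_pos
    have hR : (0 : ℝ) < Fintype.card R := by exact_mod_cast Fintype.card_pos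
    have hC0 : 0 < C := by linarith
    refine ⟨fun a => ?_, ?_⟩
    · dsimp only
      rcases ε a with x | r
      · rw [Sum.elim_inl]
        positivity
      · have : 2 / C ≤ 1 := (div_le_one hC0).2 hC
        rw [Sum.elim_inr]
        exact div_nonneg (by linarith) hR.le
    · rw [sum_eq_sum_pairs ε fun _ => true]
      simp only [Equiv.apply_symm_apply, Sum.elim_inl, Sum.elim_inr, Finset.sum_const,
        Finset.card_univ, nsmul_eq_mul]
      field_simp
      ring⟩

/-- The hard instance with hidden signs `σ`: at the context `s`, the action `σ s p` of the pair
`p` has reward `1`, the other action of the pair has reward `1 - Δ`, and the spare actions have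
reward `0`. -/
noncomputable def hardInstance [Nonempty P] [Nonempty R] (ε : 𝒜 ≃ (P × Bool) ⊕ R) {C Δ : ℝ}
    (hC : 2 ≤ C) (hΔ : Δ ∈ Set.Icc (0 : ℝ) 1) (σ : 𝒮 → P → Bool) : Instance 𝒮 𝒜 where
  reward s a := Sum.elim (fun x => if x.2 = σ s x.1 then 1 else 1 - Δ) (fun _ => 0) (ε a)
  reward_mem s a := by
    rcases ε a with x | r
    · simp only [Sum.elim_inl]
      split_ifs
      · simp
      · exact ⟨by linarith [hΔ.2], by linarith [hΔ.1]⟩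
    · simp
  refPolicy := hardRef ε hC

/-- The relaxation of the hard instances in which all paired actions have reward `1` and the
spare actions have reward `1 / 2`. -/
noncomputable def relaxedInstance [Nonempty P] [Nonempty R] (ε : 𝒜 ≃ (P × Bool) ⊕ R) {C : ℝ}
    (hC : 2 ≤ C) : Instance 𝒮 𝒜 where
  reward _ a := Sum.elim (fun _ => 1) (fun _ => 1 / 2) (ε a)
  reward_mem s a := by
    rcases ε a with x | r
    · simp
    · norm_num
  refPolicy := hardRef ε hC

theorem goodMass_add_badMass_add (ε : 𝒜 ≃ (P × Bool) ⊕ R) (σ : 𝒮 → P → Bool) (π : Policy 𝒮 𝒜)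
    (s : 𝒮) :
    goodMass ε σ π s + badMass ε σ π s + ∑ r, π.1 s (ε.symm (.inr r)) = 1 := by
  rw [← (π.2 s).2, sum_eq_sum_pairs ε (σ s)]
  rfl

theorem goodMass_add_badMass_le (ε : 𝒜 ≃ (P × Bool) ⊕ R) (σ : 𝒮 → P → Bool) (π : Policy 𝒮 𝒜)
    (s : 𝒮) : goodMass ε σ π s + badMass ε σ π s ≤ 1 := by
  have h := goodMass_add_badMass_add ε σ π s
  have h0 : 0 ≤ ∑ r, π.1 s (ε.symm (.inr r)) := Finset.sum_nonneg fun _ _ => (π.2 s).1 _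
  linarith

theorem goodMass_le_one (ε : 𝒜 ≃ (P × Bool) ⊕ R) (σ : 𝒮 → P → Bool) (π : Policy 𝒮 𝒜) (s : 𝒮) :
    goodMass ε σ π s ≤ 1 := by
  have h := goodMass_add_badMass_le ε σ π s
  have h0 : 0 ≤ badMass ε σ π s := Finset.sum_nonneg fun _ _ => (π.2 s).1 _
  linarith

variable [Nonempty P] [Nonempty R] (ε : 𝒜 ≃ (P × Bool) ⊕ R) {C Δ : ℝ} (hC : 2 ≤ C)
  (hΔ : Δ ∈ Set.Icc (0 : ℝ) 1) (σ : 𝒮 → P → Bool)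

theorem exp_div_le_partition_hardInstance (η : ℝ) (s : 𝒮) :
    Real.exp η / C ≤ partition η (hardInstance ε hC hΔ σ) s := by
  have hP : (0 : ℝ) < Fintype.card P := by exact_mod_cast Fintype.card_pos
  have hC0 : 0 < C := by linarith
  have hnn : ∀ a, 0 ≤ (hardInstance ε hC hΔ σ).refPolicy.1 s a *
      Real.exp (η * (hardInstance ε hC hΔ σ).reward s a) := fun a =>
    mul_nonneg (((hardInstance ε hC hΔ σ).refPolicy.2 s).1 a) (Real.exp_pos _).le
  rw [partition, sum_eq_sum_pairs ε (σ s)]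
  have hgood : ∑ p, (hardInstance ε hC hΔ σ).refPolicy.1 s (ε.symm (.inl (p, σ s p))) *
      Real.exp (η * (hardInstance ε hC hΔ σ).reward s (ε.symm (.inl (p, σ s p)))) =
      Real.exp η / C := by
    simp only [hardInstance, hardRef, Equiv.apply_symm_apply, Sum.elim_inl, if_true,
      Finset.sum_const, Finset.card_univ, nsmul_eq_mul, mul_one]
    field_simp
  have h1 := Finset.sum_nonneg fun p (_ : p ∈ Finset.univ) => hnn (ε.symm (.inl (p, !σ s p)))
  have h2 := Finset.sum_nonneg fun r (_ : r ∈ Finset.univ) => hnn (ε.symm (.inr r))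
  linarith

theorem hardInstance_mem_MAB {η : ℝ} (hη : 0 ≤ η) : hardInstance ε hC hΔ σ ∈ MAB 𝒮 𝒜 η C := by
  have hC0 : 0 < C := by linarith
  refine Real.iSup_le (fun x => ?_) hC0.le
  set I := hardInstance ε hC hΔ σ
  rcases eq_or_ne (I.refPolicy.1 x.1 x.2) 0 with h | h
  · simp [h, hC0.le]
  have e : (optPolicy η I).1 x.1 x.2 / I.refPolicy.1 x.1 x.2 =
      Real.exp (η * I.reward x.1 x.2) / partition η I x.1 := by
    simp only [optPolicy]
    field_simp
  rw [e, div_le_iff₀ (partition_pos η I x.1)]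
  have h1 : Real.exp (η * I.reward x.1 x.2) ≤ Real.exp η :=
    Real.exp_le_exp.2 (mul_le_of_le_one_right hη (I.reward_mem x.1 x.2).2)
  have h2 := (div_le_iff₀ hC0).1 (exp_div_le_partition_hardInstance ε hC hΔ σ η x.1)
  linarith

theorem partition_relaxedInstance_le {η : ℝ} (hCη : C ≤ Real.exp (η / 2)) (s : 𝒮) :
    partition η (relaxedInstance ε hC) s ≤ 3 * partition η (hardInstance ε hC hΔ σ) s := by
  have hP : (0 : ℝ) < Fintype.card P := by exact_mod_cast Fintype.card_pos
  have hR : (0 : ℝ) < Fintype.card R := by exact_mod_cast Fintype.card_pos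
  have hC0 : 0 < C := by linarith
  have h := exp_div_le_partition_hardInstance ε hC hΔ σ η s
  have he : partition η (relaxedInstance ε hC) s =
      2 / C * Real.exp η + (1 - 2 / C) * Real.exp (η / 2) := by
    rw [partition, sum_eq_sum_pairs ε (σ s)]
    simp only [relaxedInstance, hardRef, Equiv.apply_symm_apply, Sum.elim_inl, Sum.elim_inr,
      Finset.sum_const, Finset.card_univ, nsmul_eq_mul, mul_one, mul_one_div]
    field_simp
    ring
  have hhalf : Real.exp η = Real.exp (η / 2) * Real.exp (η / 2) := by
    rw [← Real.exp_add, add_halves]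
  have h2 : Real.exp (η / 2) ≤ Real.exp η / C := by
    rw [le_div_iff₀ hC0, hhalf]
    exact mul_le_mul_of_nonneg_left hCη (Real.exp_pos _).le
  have h3 : 0 ≤ 2 / C * Real.exp (η / 2) := by positivity
  have h4 : 2 / C * Real.exp η = 2 * (Real.exp η / C) := by ring
  rw [he]
  linarith

variable [Fintype 𝒮]

/-- The suboptimality of a policy is at least `Δ` times the mass that misses the best actions, up
to the entropic gain of at most `log 3 / η`. -/
theorem le_subOpt_hardInstance (ρ : stdSimplex ℝ 𝒮) (hΔ2 : Δ ≤ 1 / 2) {η : ℝ} (hη : 0 < η)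
    (hCη : C ≤ Real.exp (η / 2)) (π : Policy 𝒮 𝒜) :
    ENNReal.ofReal (∑ s, ρ.1 s * (Δ * (1 - goodMass ε σ π s))) ≤
      subOpt ρ η (hardInstance ε hC hΔ σ) π + ENNReal.ofReal (Real.log 3 / η) := by
  rw [subOpt]
  split_ifs with h
  · refine le_trans ?_ ENNReal.ofReal_add_le
    refine ENNReal.ofReal_le_ofReal ?_
    have hsub := le_objective_sub_objective hη (I := hardInstance ε hC hΔ σ)
      (I' := relaxedInstance ε hC) rfl h three_pos
      (partition_relaxedInstance_le ε hC hΔ σ hCη)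
    refine le_trans (Finset.sum_le_sum fun s _ => mul_le_mul_of_nonneg_left ?_ (ρ.2.1 s))
      (sub_le_iff_le_add.1 hsub)
    rw [sum_eq_sum_pairs ε (σ s)]
    have hm := goodMass_add_badMass_add ε σ π s
    have h0 : 0 ≤ ∑ r, π.1 s (ε.symm (.inr r)) := Finset.sum_nonneg fun _ _ => (π.2 s).1 _
    simp only [relaxedInstance, hardInstance, Equiv.apply_symm_apply, Sum.elim_inl, Sum.elim_inr,
      if_true, Bool.not_eq_self, if_false, ← Finset.sum_mul]
    change _ ≤ goodMass ε σ π s * _ + badMass ε σ π s * _ + _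
    nlinarith
  · simp

end Hard


/-! ### Flipping one hidden sign -/

section Flip

variable {𝒮 P : Type*} [DecidableEq 𝒮] [DecidableEq P]

/-- The signs `σ` with the one at the context `s` and the pair `p` reversed. -/
def flipSign (s : 𝒮) (p : P) (σ : 𝒮 → P → Bool) : 𝒮 → P → Bool :=
  fun s' p' => xor (σ s' p') (decide (s' = s ∧ p' = p))

theorem flipSign_involutive (s : 𝒮) (p : P) : Function.Involutive (flipSign s p) := by
  intro σ
  ext s' p'
  simp [flipSign]

theorem flipSign_self (s : 𝒮) (p : P) (σ : 𝒮 → P → Bool) : flipSign s p σ s p = !σ s p := by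
  simp [flipSign]

end Flip

section Tail

variable {𝒮 𝒜 P R : Type*} [Fintype 𝒜] [Fintype P] [Fintype R] [Nonempty P] [Nonempty R]
  [DecidableEq 𝒮] [DecidableEq P] (ε : 𝒜 ≃ (P × Bool) ⊕ R) {C Δ : ℝ} (hC : 2 ≤ C)
  (hΔ : Δ ∈ Set.Icc (0 : ℝ) 1) (σ : 𝒮 → P → Bool)

theorem sq_reward_flipSign_sub (s s' : 𝒮) (p : P) (a : 𝒜) :
    ((hardInstance ε hC hΔ (flipSign s p σ)).reward s' a -
      (hardInstance ε hC hΔ σ).reward s' a) ^ 2 =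
      Sum.elim (fun x => if s' = s ∧ x.1 = p then Δ ^ 2 else 0) (fun _ => 0) (ε a) := by
  simp only [hardInstance]
  rcases ε a with ⟨p', b⟩ | r
  · simp only [Sum.elim_inl, flipSign]
    by_cases h : s' = s ∧ p' = p
    · obtain ⟨rfl, rfl⟩ := h
      rcases Bool.eq_false_or_eq_true (σ s' p') with hb | hb <;> cases b <;> simp [hb]
    · simp [h]
  · simp

variable [Fintype 𝒮] [Nonempty 𝒮]

theorem sum_exp_sq_reward_flipSign_sub (s : 𝒮) (p : P) (k : ℝ) :
    ∑ s', ∑ a, (unif 𝒮).1 s' * (hardInstance ε hC hΔ σ).refPolicy.1 s' a *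
      Real.exp (k * ((hardInstance ε hC hΔ (flipSign s p σ)).reward s' a -
        (hardInstance ε hC hΔ σ).reward s' a) ^ 2 / 2) =
      1 + 2 / (Fintype.card 𝒮 * C * Fintype.card P) * (Real.exp (k * Δ ^ 2 / 2) - 1) := by
  have hP : (0 : ℝ) < Fintype.card P := by exact_mod_cast Fintype.card_pos
  have hS : (0 : ℝ) < Fintype.card 𝒮 := by exact_mod_cast Fintype.card_pos
  have hC0 : 0 < C := by linarith
  have hsplit : ∀ s' a, (unif 𝒮).1 s' * (hardInstance ε hC hΔ σ).refPolicy.1 s' a *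
      Real.exp (k * ((hardInstance ε hC hΔ (flipSign s p σ)).reward s' a -
        (hardInstance ε hC hΔ σ).reward s' a) ^ 2 / 2) =
      (unif 𝒮).1 s' * (hardInstance ε hC hΔ σ).refPolicy.1 s' a +
      Sum.elim (fun x => if s' = s ∧ x.1 = p then 1 / (Fintype.card 𝒮 * C * Fintype.card P) *
        (Real.exp (k * Δ ^ 2 / 2) - 1) else 0) (fun _ => 0) (ε a) := by
    intro s' a
    rw [sq_reward_flipSign_sub]
    simp only [hardInstance, hardRef, unif]
    rcases ε a with x | r
    · simp only [Sum.elim_inl]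
      split_ifs
      · field_simp
        ring
      · simp
    · simp
  simp only [hsplit, Finset.sum_add_distrib, ← Finset.mul_sum]
  have h1 : ∑ s', (unif 𝒮).1 s' * ∑ a, (hardInstance ε hC hΔ σ).refPolicy.1 s' a = 1 := by
    simp only [((hardInstance ε hC hΔ σ).refPolicy.2 _).2, mul_one]
    exact (unif 𝒮).2.2
  rw [h1]
  congr 1
  simp only [sum_eq_sum_pairs ε fun _ => true, Equiv.apply_symm_apply, Sum.elim_inl, Sum.elim_inr,
    Finset.sum_const_zero, add_zero, ite_and, Finset.sum_add_distrib]
  simp only [Finset.sum_ite_irrel, Finset.sum_ite_eq', Finset.mem_univ, if_true,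
    Finset.sum_const_zero]
  ring

variable [MeasurableSpace 𝒮] [MeasurableSpace 𝒜] [MeasurableSingletonClass 𝒮]
  [MeasurableSingletonClass 𝒜]

/-- With probability at least `1 / 2`, at the context `s` no flip of a single sign of `σ` has a
likelihood ratio below `exp (-2)`. The exponent `l` of the Chernoff bound is to be taken of the
order of the logarithm of the number of pairs, to pay for the union bound; this forces `Δ` to be
smaller than the noise level of one pair by a factor `√l`. -/
theorem dataLaw_exists_logLR_lt_le {n : ℕ} {l : ℝ} (hl : 1 ≤ l) (hlΔ : (l * Δ) ^ 2 ≤ 1)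
    (hn : n * (4 / (Fintype.card 𝒮 * C * Fintype.card P) * (l * Δ) ^ 2) ≤ l)
    (hP : 2 * Fintype.card P ≤ Real.exp l) (s : 𝒮) :
    dataLaw (unif 𝒮) (gaussianReal 0 1) (hardInstance ε hC hΔ σ) n
      {D | ∃ p, ∑ i, logLR (hardInstance ε hC hΔ σ) (hardInstance ε hC hΔ (flipSign s p σ)) (D i) <
        -2} ≤ 2⁻¹ := by
  have hP0 : (0 : ℝ) < Fintype.card P := by exact_mod_cast Fintype.card_pos
  have hS : (0 : ℝ) < Fintype.card 𝒮 := by exact_mod_cast Fintype.card_pos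
  have hC0 : 0 < C := by linarith
  set w : ℝ := 2 / (Fintype.card 𝒮 * C * Fintype.card P) with hw
  have hw0 : 0 ≤ w := by positivity
  set y : ℝ := (l ^ 2 + l) * Δ ^ 2 / 2 with hy
  have hy0 : 0 ≤ y := by positivity
  have hy1 : y ≤ (l * Δ) ^ 2 := by
    have : l * Δ ^ 2 ≤ l ^ 2 * Δ ^ 2 :=
      mul_le_mul_of_nonneg_right (by nlinarith) (sq_nonneg Δ)
    rw [hy, mul_pow]
    linarith
  have hexp : Real.exp y - 1 ≤ 2 * (l * Δ) ^ 2 := by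
    have h := Real.abs_exp_sub_one_le (x := y) (by rw [abs_of_nonneg hy0]; linarith)
    rw [abs_of_nonneg hy0] at h
    linarith [le_abs_self (Real.exp y - 1)]
  have hpow : (1 + w * (Real.exp y - 1)) ^ n ≤ Real.exp l := by
    have h0 : 0 ≤ w * (Real.exp y - 1) :=
      mul_nonneg hw0 (by linarith [Real.add_one_le_exp y])
    calc (1 + w * (Real.exp y - 1)) ^ n ≤ Real.exp (w * (Real.exp y - 1)) ^ n :=
          pow_le_pow_left₀ (by linarith) (by linarith [Real.add_one_le_exp (w * (Real.exp y - 1))]) n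
      _ = Real.exp (n * (w * (Real.exp y - 1))) := (Real.exp_nat_mul _ _).symm
      _ ≤ Real.exp l := by
          refine Real.exp_le_exp.2 (le_trans ?_ hn)
          refine mul_le_mul_of_nonneg_left ?_ n.cast_nonneg
          calc w * (Real.exp y - 1) ≤ w * (2 * (l * Δ) ^ 2) := mul_le_mul_of_nonneg_left hexp hw0
            _ = _ := by rw [hw]; ring
  have hone : ∀ p, dataLaw (unif 𝒮) (gaussianReal 0 1) (hardInstance ε hC hΔ σ) n
      {D | ∑ i, logLR (hardInstance ε hC hΔ σ) (hardInstance ε hC hΔ (flipSign s p σ)) (D i) <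
        -2} ≤ ENNReal.ofReal (Real.exp (-l)) := by
    intro p
    refine (dataLaw_logLR_lt_le _ _ _ n (zero_le_one.trans hl) 2).trans (ENNReal.ofReal_le_ofReal ?_)
    rw [sum_exp_sq_reward_flipSign_sub]
    calc _ ≤ Real.exp (-(l * 2)) * Real.exp l :=
          mul_le_mul_of_nonneg_left hpow (Real.exp_pos _).le
      _ = Real.exp (-l) := by rw [← Real.exp_add]; ring_nf
  have hset : {D : Fin n → 𝒮 × 𝒜 × ℝ | ∃ p, ∑ i, logLR (hardInstance ε hC hΔ σ)
      (hardInstance ε hC hΔ (flipSign s p σ)) (D i) < -2} =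
      ⋃ p, {D | ∑ i, logLR (hardInstance ε hC hΔ σ)
        (hardInstance ε hC hΔ (flipSign s p σ)) (D i) < -2} := by
    ext D
    simp
  rw [hset]
  refine (measure_iUnion_fintype_le _ _).trans ((Finset.sum_le_sum fun p _ => hone p).trans ?_)
  rw [Finset.sum_const, Finset.card_univ, nsmul_eq_mul, ← ENNReal.ofReal_natCast,
    ← ENNReal.ofReal_mul hP0.le, ← ENNReal.ofReal_ofNat 2, ← ENNReal.ofReal_inv_of_pos two_pos]
  refine ENNReal.ofReal_le_ofReal ?_
  rw [Real.exp_neg, ← div_eq_mul_inv, div_le_iff₀ (Real.exp_pos l)]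
  linarith

end Tail

/-! ### Averaging over the hidden signs -/

theorem measurable_policy_apply {𝒮 𝒜 Ω : Type*} [Fintype 𝒜] [MeasurableSpace Ω] {π : Ω → Policy 𝒮 𝒜}
    (hπ : Measurable π) (s : 𝒮) (a : 𝒜) : Measurable fun D => (π D).1 s a :=
  (measurable_pi_apply a).comp ((measurable_pi_apply s).comp (measurable_subtype_coe.comp hπ))

section Average

variable {𝒮 𝒜 P R : Type*} [Fintype 𝒜] [Fintype P] [Fintype R] [Nonempty P] [Nonempty R]
  [DecidableEq 𝒮] [DecidableEq P] (ε : 𝒜 ≃ (P × Bool) ⊕ R) {C Δ : ℝ} (hC : 2 ≤ C)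
  (hΔ : Δ ∈ Set.Icc (0 : ℝ) 1)
  [MeasurableSpace 𝒮] [MeasurableSpace 𝒜]

variable [Fintype 𝒮] [MeasurableSingletonClass 𝒮] [MeasurableSingletonClass 𝒜]

/-- On average over the signs `σ`, a learned policy misses a constant part of the good actions:
reversing the sign of a pair turns its good action into its bad one, at the price of a likelihood
ratio, and the likelihood ratios of all pairs are bounded below simultaneously with probability
at least `1 / 2`. -/
theorem card_mul_le_sum_lintegral_one_sub_goodMass (ρ : stdSimplex ℝ 𝒮) {n : ℕ} {s : 𝒮}
    (htail : ∀ σ, dataLaw ρ (gaussianReal 0 1) (hardInstance ε hC hΔ σ) n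
      {D | ∃ p, ∑ i, logLR (hardInstance ε hC hΔ σ) (hardInstance ε hC hΔ (flipSign s p σ)) (D i) <
        -2} ≤ 2⁻¹)
    {π : (Fin n → 𝒮 × 𝒜 × ℝ) → Policy 𝒮 𝒜} (hπ : Measurable π) :
    ENNReal.ofReal (Real.exp (-2)) * (Fintype.card (𝒮 → P → Bool) * 2⁻¹) ≤
      2 * ∑ σ : 𝒮 → P → Bool, ∫⁻ D, ENNReal.ofReal (1 - goodMass ε σ (π D) s)
        ∂(dataLaw ρ (gaussianReal 0 1) (hardInstance ε hC hΔ σ) n) := by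
  set μ : (𝒮 → P → Bool) → Measure (Fin n → 𝒮 × 𝒜 × ℝ) := fun σ =>
    dataLaw ρ (gaussianReal 0 1) (hardInstance ε hC hΔ σ) n with hμ
  have hprob : ∀ σ, IsProbabilityMeasure (μ σ) := fun σ => by
    rw [hμ]
    unfold dataLaw
    infer_instance
  set F : P → Bool → (Fin n → 𝒮 × 𝒜 × ℝ) → ℝ≥0∞ := fun p b D =>
    ENNReal.ofReal ((π D).1 s (ε.symm (.inl (p, b)))) with hF
  have hFm : ∀ p b, Measurable (F p b) := fun p b => (measurable_policy_apply hπ s _).ennreal_ofReal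
  set L : (𝒮 → P → Bool) → P → (Fin n → 𝒮 × 𝒜 × ℝ) → ℝ := fun σ p D =>
    ∑ i, logLR (hardInstance ε hC hΔ σ) (hardInstance ε hC hΔ (flipSign s p σ)) (D i) with hL
  have hLm : ∀ σ p, Measurable (L σ p) := fun σ p => by rw [hL]; fun_prop
  set E : (𝒮 → P → Bool) → Set (Fin n → 𝒮 × 𝒜 × ℝ) := fun σ => {D | ∃ p, L σ p D < -2}ᶜ with hE
  have hEm : ∀ σ, MeasurableSet (E σ) := fun σ => by
    have : {D | ∃ p, L σ p D < -2} = ⋃ p, {D | L σ p D < -2} := by ext D; simp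
    rw [hE]
    dsimp only
    rw [this]
    exact (MeasurableSet.iUnion fun p => measurableSet_lt (hLm σ p) measurable_const).compl
  have hEP : ∀ σ, 2⁻¹ ≤ μ σ (E σ) := fun σ => by
    have hc : μ σ (E σ)ᶜ ≤ 2⁻¹ := by simpa only [hE, compl_compl] using htail σ
    have h := prob_compl_eq_one_sub (μ := μ σ) (hEm σ).compl
    rw [compl_compl] at h
    rw [h, ← ENNReal.one_sub_inv_two]
    exact tsub_le_tsub_left hc 1
  have hG : ∀ σ D, ENNReal.ofReal (goodMass ε σ (π D) s) = ∑ p, F p (σ s p) D := fun σ D =>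
    ENNReal.ofReal_sum_of_nonneg fun p _ => ((π D).2 s).1 _
  have hB : ∀ σ D, ENNReal.ofReal (badMass ε σ (π D) s) = ∑ p, F p (!σ s p) D := fun σ D =>
    ENNReal.ofReal_sum_of_nonneg fun p _ => ((π D).2 s).1 _
  set τ := ENNReal.ofReal (Real.exp (-2)) with hτ
  set X := ∑ σ : 𝒮 → P → Bool, ∫⁻ D, ENNReal.ofReal (1 - goodMass ε σ (π D) s) ∂(μ σ) with hX
  set Y := ∑ σ : 𝒮 → P → Bool, ∫⁻ D in E σ, ENNReal.ofReal (goodMass ε σ (π D) s) ∂(μ σ) with hY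
  -- Change of measure: the bad action of a pair is its good action after the flip.
  have hflip : ∀ p, τ * ∑ σ, ∫⁻ D in E σ, F p (σ s p) D ∂(μ σ) ≤
      ∑ σ, ∫⁻ D, F p (!σ s p) D ∂(μ σ) := by
    intro p
    rw [← Equiv.sum_comp (flipSign_involutive s p).toPerm fun σ => ∫⁻ D, F p (!σ s p) D ∂(μ σ),
      Finset.mul_sum]
    refine Finset.sum_le_sum fun σ _ => ?_
    rw [Function.Involutive.coe_toPerm, flipSign_self, Bool.not_not]
    have hden : μ (flipSign s p σ) = (μ σ).withDensity fun D => ENNReal.ofReal (Real.exp (L σ p D)) :=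
      dataLaw_eq_withDensity ρ (I := hardInstance ε hC hΔ σ)
        (I' := hardInstance ε hC hΔ (flipSign s p σ)) rfl n
    rw [hden, lintegral_withDensity_eq_lintegral_mul _ (hLm σ p).exp.ennreal_ofReal (hFm p _),
      ← lintegral_const_mul _ (hFm p _)]
    refine le_trans (setLIntegral_mono' (hEm σ) fun D hD => ?_) (setLIntegral_le_lintegral (E σ) _)
    have hD' : -2 ≤ L σ p D := not_lt.1 fun h => hD ⟨p, h⟩
    exact mul_le_mul_left (ENNReal.ofReal_le_ofReal (Real.exp_le_exp.2 hD')) _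
  have hYX : τ * Y ≤ X := by
    have h1 : τ * Y = ∑ p, τ * ∑ σ, ∫⁻ D in E σ, F p (σ s p) D ∂(μ σ) := by
      rw [← Finset.mul_sum, Finset.sum_comm, hY]
      congr 1
      refine Finset.sum_congr rfl fun σ _ => ?_
      rw [← lintegral_finsetSum _ fun p _ => hFm p _]
      exact lintegral_congr fun D => hG σ D
    rw [h1]
    refine (Finset.sum_le_sum fun p _ => hflip p).trans ?_
    rw [Finset.sum_comm]
    refine Finset.sum_le_sum fun σ _ => ?_
    rw [← lintegral_finsetSum _ fun p _ => hFm p _]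
    refine lintegral_mono fun D => ?_
    dsimp only
    rw [← hB]
    exact ENNReal.ofReal_le_ofReal (by linarith [goodMass_add_badMass_le ε σ (π D) s])
  -- On the event `E σ` the good mass and the missing mass add up to one.
  have hXY : Fintype.card (𝒮 → P → Bool) * 2⁻¹ ≤ Y + X := by
    rw [hX, hY, ← Finset.sum_add_distrib, ← nsmul_eq_mul, ← Finset.card_univ, ← Finset.sum_const]
    refine Finset.sum_le_sum fun σ _ => (hEP σ).trans ?_
    refine le_trans ?_ (add_le_add_right (setLIntegral_le_lintegral (E σ) _) _)
    have hGm : Measurable fun D => ENNReal.ofReal (goodMass ε σ (π D) s) := by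
      simp only [hG]
      exact Finset.measurable_fun_sum _ fun p _ => hFm p _
    rw [← lintegral_add_left hGm, ← setLIntegral_one]
    refine lintegral_mono fun D => ?_
    dsimp only
    rw [← ENNReal.ofReal_add (goodMass_nonneg ε σ _ s)
      (by linarith [goodMass_le_one ε σ (π D) s])]
    simp
  have hτ1 : τ ≤ 1 := by
    rw [hτ, ENNReal.ofReal_le_one]
    exact Real.exp_le_one_iff.2 (by norm_num)
  calc τ * (Fintype.card (𝒮 → P → Bool) * 2⁻¹) ≤ τ * (Y + X) := by gcongr
    _ = τ * Y + τ * X := mul_add _ _ _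
    _ ≤ X + 1 * X := by gcongr
    _ = 2 * X := by rw [one_mul, two_mul]

/-- Lower bound for the worst-case risk of an algorithm on the hard instances. -/
theorem le_iSup_risk_add (ρ : stdSimplex ℝ 𝒮) {n : ℕ} (hΔ2 : Δ ≤ 1 / 2) {η : ℝ} (hη : 0 < η)
    (hCη : C ≤ Real.exp (η / 2))
    (htail : ∀ s σ, dataLaw ρ (gaussianReal 0 1) (hardInstance ε hC hΔ σ) n
      {D | ∃ p, ∑ i, logLR (hardInstance ε hC hΔ σ) (hardInstance ε hC hΔ (flipSign s p σ)) (D i) <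
        -2} ≤ 2⁻¹) (alg : Algorithm 𝒮 𝒜 n) :
    ENNReal.ofReal (Δ * Real.exp (-2) / 4) ≤
      (⨆ I ∈ MAB 𝒮 𝒜 η C, risk ρ (gaussianReal 0 1) η n alg I) +
        ENNReal.ofReal (Real.log 3 / η) := by
  set M := ⨆ I ∈ MAB 𝒮 𝒜 η C, risk ρ (gaussianReal 0 1) η n alg I with hM
  set π : (Fin n → 𝒮 × 𝒜 × ℝ) → Policy 𝒮 𝒜 := alg.run (hardRef ε hC) with hπ
  have hπm : Measurable π := alg.measurable_run _
  set μ : (𝒮 → P → Bool) → Measure (Fin n → 𝒮 × 𝒜 × ℝ) := fun σ =>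
    dataLaw ρ (gaussianReal 0 1) (hardInstance ε hC hΔ σ) n with hμ
  have hprob : ∀ σ, IsProbabilityMeasure (μ σ) := fun σ => by
    rw [hμ]
    unfold dataLaw
    infer_instance
  set U : 𝒮 → (𝒮 → P → Bool) → ℝ≥0∞ := fun s σ =>
    ∫⁻ D, ENNReal.ofReal (1 - goodMass ε σ (π D) s) ∂(μ σ) with hU
  have hUm : ∀ s σ, Measurable fun D => ENNReal.ofReal (1 - goodMass ε σ (π D) s) := fun s σ =>
    (measurable_const.sub (Finset.measurable_fun_sum _ fun p _ =>
      measurable_policy_apply hπm s _)).ennreal_ofReal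
  have hrisk : ∀ σ, ∑ s, ENNReal.ofReal (ρ.1 s * Δ) * U s σ ≤
      M + ENNReal.ofReal (Real.log 3 / η) := by
    intro σ
    have h1 : risk ρ (gaussianReal 0 1) η n alg (hardInstance ε hC hΔ σ) ≤ M :=
      le_iSup₂_of_le _ (hardInstance_mem_MAB ε hC hΔ σ hη.le) le_rfl
    refine le_trans ?_ (add_le_add_left h1 _)
    have h2 : ∑ s, ENNReal.ofReal (ρ.1 s * Δ) * U s σ =
        ∫⁻ D, ENNReal.ofReal (∑ s, ρ.1 s * (Δ * (1 - goodMass ε σ (π D) s))) ∂(μ σ) := by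
      simp only [hU, ← lintegral_const_mul _ (hUm _ σ)]
      rw [← lintegral_finsetSum _ fun s _ => (hUm s σ).const_mul _]
      refine lintegral_congr fun D => ?_
      have h0 : ∀ s, 0 ≤ 1 - goodMass ε σ (π D) s := fun s => by
        linarith [goodMass_le_one ε σ (π D) s]
      rw [ENNReal.ofReal_sum_of_nonneg fun s _ =>
        mul_nonneg (ρ.2.1 s) (mul_nonneg hΔ.1 (h0 s))]
      refine Finset.sum_congr rfl fun s _ => ?_
      rw [← ENNReal.ofReal_mul (mul_nonneg (ρ.2.1 s) hΔ.1), mul_assoc]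
    rw [h2, risk]
    refine (lintegral_mono fun D =>
      le_subOpt_hardInstance ε hC hΔ σ ρ hΔ2 hη hCη (π D)).trans ?_
    rw [lintegral_add_right _ measurable_const, lintegral_const, measure_univ, mul_one]
    rfl
  have hN0 : (Fintype.card (𝒮 → P → Bool) : ℝ≥0∞) ≠ 0 := by simp
  have hNt : (Fintype.card (𝒮 → P → Bool) : ℝ≥0∞) ≠ ⊤ := ENNReal.natCast_ne_top _
  set N : ℝ≥0∞ := (Fintype.card (𝒮 → P → Bool) : ℝ≥0∞)
  have hsum : ∑ σ, ∑ s, ENNReal.ofReal (ρ.1 s * Δ) * U s σ ≤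
      N * (M + ENNReal.ofReal (Real.log 3 / η)) := by
    refine (Finset.sum_le_sum fun σ _ => hrisk σ).trans ?_
    rw [Finset.sum_const, Finset.card_univ, nsmul_eq_mul]
  rw [Finset.sum_comm] at hsum
  have hkey : ∑ s, ENNReal.ofReal (ρ.1 s * Δ) *
      (N * ENNReal.ofReal (Real.exp (-2) / 4)) ≤
      N * (M + ENNReal.ofReal (Real.log 3 / η)) := by
    refine le_trans (Finset.sum_le_sum fun s _ => ?_) hsum
    rw [← Finset.mul_sum]
    gcongr
    have h := card_mul_le_sum_lintegral_one_sub_goodMass ε hC hΔ ρ (htail s) hπm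
    have h4 : N * ENNReal.ofReal (Real.exp (-2) / 4) =
        2⁻¹ * (ENNReal.ofReal (Real.exp (-2)) * (N * 2⁻¹)) := by
      have : Real.exp (-2) / 4 = 2⁻¹ * (Real.exp (-2) * 2⁻¹) := by ring
      rw [this, ENNReal.ofReal_mul (by norm_num), ENNReal.ofReal_mul (Real.exp_pos _).le,
        ENNReal.ofReal_inv_of_pos two_pos, ENNReal.ofReal_ofNat]
      ring
    rw [h4]
    calc _ ≤ 2⁻¹ * (2 * ∑ σ, U s σ) := by gcongr
      _ = ∑ σ, U s σ := by
        rw [← mul_assoc, ENNReal.inv_mul_cancel two_ne_zero ENNReal.ofNat_ne_top, one_mul]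
  rw [← Finset.sum_mul, ← ENNReal.ofReal_sum_of_nonneg fun s _ => mul_nonneg (ρ.2.1 s) hΔ.1,
    ← Finset.sum_mul, ρ.2.2, one_mul, mul_left_comm,
    ENNReal.mul_le_mul_iff_right hN0 hNt, ← ENNReal.ofReal_mul hΔ.1] at hkey
  rwa [mul_div_assoc]

end Average

end KLBandit

/-! ### The minimax lower bound -/

theorem mainTheorem3 :
    ∃ K : ℝ, 0 < K ∧ ∃ c : ℝ, 0 < c ∧
      ∀ (S A n : ℕ) [NeZero S] (η C : ℝ),
        1 < S → 3 < A → 10 * Real.log A ≤ η → 4 < C → C ≤ Real.exp (η / 2) →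
        S * A * C * Real.log A ≤ n →
        K * (n * Real.log A / (S * A * C)) ≤ η ^ 2 →
        ENNReal.ofReal (c * Real.sqrt (S * A * C / (n * Real.log A))) ≤
          KLBandit.minimaxRisk (KLBandit.unif (Fin S)) (ProbabilityTheory.gaussianReal 0 1)
            (Fin A) η C n := by
  -- The risk is at least `Δ exp (-2) / 4 - log 3 / η` with `Δ = √q / 4`, where `√q` is the rate.
  -- As `exp (-2) ≥ 1 / 9`, the first term is at least `√q / 144`; `K` is chosen so that the
  -- entropic term takes away at most half of it.
  refine ⟨576 ^ 2, by norm_num, 1 / 288, by norm_num, ?_⟩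
  intro S A n _ η C hS hA hηA hC hCη hn hK
  -- There are `k` pairs of actions; at least one spare action must remain to carry the mass
  -- `1 - 2 / C` of the reference policy.
  obtain ⟨k, r, hk, hr, hA2, hAk⟩ : ∃ k r : ℕ, 0 < k ∧ 0 < r ∧ A = k * 2 + r ∧ A ≤ 4 * k :=
    ⟨(A - 1) / 2, A - (A - 1) / 2 * 2, by omega, by omega, by omega, by omega⟩
  have hS0 : (0 : ℝ) < S := by exact_mod_cast (by omega : 0 < S)
  have hA0 : (0 : ℝ) < A := by exact_mod_cast (by omega : 0 < A)
  have hk0 : (0 : ℝ) < k := by exact_mod_cast hk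
  have hAk' : (A : ℝ) ≤ 4 * k := by exact_mod_cast hAk
  have hkA : (2 : ℝ) * k ≤ A := by exact_mod_cast (by omega : 2 * k ≤ A)
  have hC0 : 0 < C := by linarith
  have hL : 1 ≤ Real.log A := by
    rw [Real.le_log_iff_exp_le hA0]
    have : (4 : ℝ) ≤ A := by exact_mod_cast hA
    linarith [Real.exp_one_lt_three]
  set L := Real.log A
  have hL0 : 0 < L := by linarith
  have hη : 0 < η := by linarith
  have hn0 : (0 : ℝ) < n := lt_of_lt_of_le (by positivity) hn
  set q : ℝ := S * A * C / (n * L) with hq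
  have hq0 : 0 < q := by positivity
  have hqL : L ^ 2 * q ≤ 1 := by
    have : L ^ 2 * q = S * A * C * L / n := by rw [hq]; field_simp
    rw [this, div_le_one hn0]
    exact hn
  have hsq : Real.sqrt q ^ 2 = q := Real.sq_sqrt hq0.le
  have hsq0 : 0 < Real.sqrt q := Real.sqrt_pos.2 hq0
  have hsq1 : Real.sqrt q ≤ 1 := Real.sqrt_le_iff.2 ⟨zero_le_one, by
    linarith [mul_le_mul_of_nonneg_right (one_le_pow₀ hL (n := 2)) hq0.le]⟩
  have hΔ : Real.sqrt q / 4 ∈ Set.Icc (0 : ℝ) 1 := ⟨by positivity, by linarith⟩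
  have hlΔ : (L * (Real.sqrt q / 4)) ^ 2 = L ^ 2 * q / 16 := by rw [mul_pow, div_pow, hsq]; ring
  have : Nonempty (Fin k) := ⟨⟨0, hk⟩⟩
  have : Nonempty (Fin r) := ⟨⟨0, hr⟩⟩
  let ε : Fin A ≃ (Fin k × Bool) ⊕ Fin r := Fintype.equivOfCardEq (by simp [hA2])
  have hlog3 : Real.log 3 / η ≤ Real.sqrt q / 288 := by
    have hηq : 576 ≤ η * Real.sqrt q := by
      have hinv : (n : ℝ) * L / (S * A * C) = q⁻¹ := (inv_div _ _).symm
      rw [hinv, ← div_eq_mul_inv, div_le_iff₀ hq0] at hK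
      refine le_of_sq_le_sq ?_ (by positivity)
      rwa [mul_pow, hsq]
    have h3 : Real.log 3 ≤ 2 := by
      have := Real.log_le_sub_one_of_pos (three_pos (α := ℝ))
      linarith
    rw [div_le_iff₀ hη]
    linarith
  have hexp : 1 / 9 ≤ Real.exp (-2) := by
    have h1 : Real.exp (-2) = (Real.exp 1)⁻¹ ^ 2 := by
      rw [← Real.exp_neg, ← Real.exp_nat_mul]
      norm_num
    have h2 : (1 / 3 : ℝ) ≤ (Real.exp 1)⁻¹ := by
      rw [one_div]
      exact inv_anti₀ (Real.exp_pos 1) Real.exp_one_lt_three.le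
    rw [h1]
    nlinarith
  refine le_iInf fun alg => ?_
  have hmain := KLBandit.le_iSup_risk_add ε (by linarith : 2 ≤ C) hΔ (KLBandit.unif (Fin S))
    (by linarith) hη hCη (fun s σ => KLBandit.dataLaw_exists_logLR_lt_le ε _ hΔ σ hL
      (by rw [hlΔ]; linarith) ?_ ?_ s) alg
  · rw [← tsub_le_iff_right, ← ENNReal.ofReal_sub _ (div_nonneg (Real.log_nonneg (by norm_num))
      hη.le)] at hmain
    refine le_trans (ENNReal.ofReal_le_ofReal ?_) hmain
    nlinarith
  · -- The expected number of observations of a pair is `2n / (SCk) ≤ 8n / (SCA)`.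
    rw [hlΔ, Fintype.card_fin, Fintype.card_fin]
    have : (n : ℝ) * (4 / (S * C * k) * (L ^ 2 * q / 16)) = L * (A / (4 * k)) := by
      rw [hq]
      field_simp
      ring
    rw [this]
    exact mul_le_of_le_one_right hL0.le ((div_le_one (by positivity)).2 hAk')
  · rw [Fintype.card_fin, Real.exp_log hA0]
    exact hkA
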